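/- Let $F$ and $H$ be probability measures on a measurable space $\mathcal X$, let $\alpha>0$, and let $X_1,X_2,\dots$ be i.i.d. with distribution $F$. For $m\ge 0$ put $$\alpha_m^*=\alpha+m,\qquad H_m^*=\frac{\alpha}{\alpha+m}H+\frac{m}{\alpha+m}\cdot\frac1m\sum_{i=1}^m\delta_{X_i},$$ and let $P_m^*$ be a random probability measure whose conditional law given $X_1,\dots,X_m$ is that of a Dirichlet process $DP(\alpha_m^*H_m^*)$ (the posterior given $X_1,\dots,X_m$ for the prior $P\sim DP(\alpha H)$). Here a random probability measure $P$ has law $DP(cG)$ if for every finite measurable partition $\{B_1,\dots,B_r\}$ of $\mathcal X$, $r\ge2$, the vector $(P(B_1),\dots,P(B_r))$ has the Dirichlet distribution with parameters $cG(B_1),\dots,cG(B_r)$, where a coordinate with parameter $0$ is almost surely $0$. Let $\{A_1,\dots,A_k\}$ be a finite measurable partition of $\mathcal X$ with $F(A_i)>0$ for all $i$, and define $$\mathcal D(P_m^*,H_m^*)=\alpha_m^*\sum_{i=1}^k\frac{(P_m^*(A_i)-H_m^*(A_i))^2}{H_m^*(A_i)},\qquad D_{KL}(P_m^*\|H_m^*)=\sum_{i=1}^kP_m^*(A_i)\log\frac{P_m^*(A_i)}{H_m^*(A_i)},$$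 the latter being the Kullback-Leibler divergence between the distributions that $P_m^*$ and $H_m^*$ induce on the cells of the partition (terms with $P_m^*(A_i)=0$ are $0$). Then, as $m\to\infty$, $$2\alpha_m^*D_{KL}(P_m^*\|H_m^*)-\mathcal D(P_m^*,H_m^*)\to0\ \text{ in probability}\qquad\text{and}\qquad \mathcal D(P_m^*,H_m^*)\overset{d}{\to}\chi^2_{k-1},$$ where $\chi^2_{k-1}$ is the law of the sum of the squares of $k-1$ independent standard normal variables. Both convergences hold under the conditional (posterior) law of $P_m^*$ given $X_1,\dots,X_m$ for almost every data sequence $(X_i)_{i\ge1}$, and also unconditionally. -/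

import Mathlib

open MeasureTheory ProbabilityTheory Filter Topology
open scoped ENNReal

noncomputable section

/-- The Gamma distribution with shape `a` and rate `1`, degenerate at `0` when `a = 0`. -/
def gammaLaw (a : ℝ) : Measure ℝ :=
  if 0 < a then gammaMeasure a 1 else Measure.dirac 0

/-- The Dirichlet distribution with parameters `a i ≥ 0`, not all zero: the law of
`(Z i / ∑ j, Z j)_i` for independent `Z i` with Gamma distribution of shape `a i`.
In particular, a coordinate with parameter zero vanishes almost surely. -/
def dirichletLaw {k : ℕ} (a : Fin k → ℝ) : Measure (Fin k → ℝ) :=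
  (Measure.pi fun i => gammaLaw (a i)).map fun z i => z i / ∑ j, z j

/-- A finite measurable partition of the space, indexed by `Fin k`. -/
structure IsMeasurablePartition {S : Type*} [MeasurableSpace S] {k : ℕ}
    (A : Fin k → Set S) : Prop where
  measurableSet : ∀ i, MeasurableSet (A i)
  disjoint : Pairwise fun i j => Disjoint (A i) (A j)
  iUnion_eq : ⋃ i, A i = Set.univ

/-- `Q`, a law on the space of probability measures, is the law `DP(c G)` of a Dirichlet process
with concentration parameter `c` and base distribution `G`: for every finite measurable partition
`A 0, …, A (k - 1)` with `k ≥ 2`, the vector of the masses of the cells under a random measure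
with law `Q` has the Dirichlet distribution with parameters `c * G (A i)`. -/
def IsDirichletProcess {S : Type*} [MeasurableSpace S] (Q : Measure (ProbabilityMeasure S))
    (c : ℝ) (G : Measure S) : Prop :=
  ∀ (k : ℕ) (A : Fin k → Set S), 2 ≤ k → IsMeasurablePartition A →
    Q.map (fun (P : ProbabilityMeasure S) (i : Fin k) => (P : Measure S).real (A i)) = dirichletLaw fun i => c * G.real (A i)

/-- The empirical distribution of `x 0, …, x (m - 1)` (the zero measure if `m = 0`). -/
def empiricalMeasure {S : Type*} [MeasurableSpace S] {m : ℕ} (x : Fin m → S) : Measure S :=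
  (m : ℝ≥0∞)⁻¹ • ∑ i, Measure.dirac (x i)

/-- The base distribution `α / (α + m) H + m / (α + m) F_m` of the posterior given a sample `x`
of size `m` with empirical distribution `F_m`, under the prior `DP(α H)`. -/
def posteriorBase {S : Type*} [MeasurableSpace S] (α : ℝ) (H : Measure S) {m : ℕ}
    (x : Fin m → S) : Measure S :=
  ENNReal.ofReal (α / (α + m)) • H + ENNReal.ofReal (m / (α + m)) • empiricalMeasure x

/-- The chi-squared statistic `c ∑ i, (P (A i) - G (A i))² / G (A i)`. -/
def chiSqStat {S : Type*} [MeasurableSpace S] {k : ℕ} (A : Fin k → Set S) (c : ℝ)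
    (P G : Measure S) : ℝ :=
  c * ∑ i, (P.real (A i) - G.real (A i)) ^ 2 / G.real (A i)

/-- The Kullback-Leibler divergence `∑ i, P (A i) log (P (A i) / G (A i))` between the discrete
distributions that `P` and `G` induce on the cells of a partition. -/
def klPartition {S : Type*} [MeasurableSpace S] {k : ℕ} (A : Fin k → Set S)
    (P G : Measure S) : ℝ :=
  ∑ i, P.real (A i) * Real.log (P.real (A i) / G.real (A i))

/-- The chi-squared distribution with `d` degrees of freedom: the law of the sum of the squares of
`d` independent standard normal random variables. -/
def chiSquared (d : ℕ) : Measure ℝ :=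
  (Measure.pi fun _ : Fin d => gaussianReal 0 1).map fun z => ∑ i, z i ^ 2

instance chiSquared_isProbabilityMeasure (d : ℕ) : IsProbabilityMeasure (chiSquared d) :=
  Measure.isProbabilityMeasure_map
    (Finset.measurable_sum _ fun i _ => (measurable_pi_apply i).pow_const 2).aemeasurable

end

/-!
The masses of the cells under the posterior have a Dirichlet distribution with parameters
`a i = c * h i`, where `c = α + m` and `h` is the vector of the cell probabilities under the
posterior base distribution. By the strong law of large numbers (`ae_tendsto_posteriorBase_real`),
`h i` tends to `F (A i) > 0` for almost every data sequence, so all `a i` tend to infinity, and what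
is left is a statement about Dirichlet distributions.

A Dirichlet vector is `Z i / ∑ j, Z j` with independent Gamma variables `Z i` of shape `a i`, hence a
deterministic function (`dirichletMap`) of the standardized variables `W i = (Z i - a i) / √(a i)`.
The characteristic function `(1 - i t) ^ (-a)` of the Gamma distribution and Lévy's theorem show that
`W` tends in law to a standard Gaussian vector (`tendsto_pi_standardizedGamma`). Both statistics are
functions of `W` depending on `m`, and they converge *continuously*, that is, along `w m → w`:
the relative deviations `√c (P i - h i) / h i` tend to `w i / √(p i) - ∑ j, √(p j) w j` with
`p i = F (A i)`, whence the chi-squared statistic tends to `∑ w i ^ 2 - (∑ √(p i) w i) ^ 2`, while the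
Taylor expansion `(1 + x) log (1 + x) = x + x² / 2 + o(x²)` shows that its difference from the
rescaled divergence tends to `0`. A continuous mapping theorem for such sequences of functions
(`tendsto_map_of_tendsto_of_continuousConvergence`) transfers these limits to laws, and by rotation
invariance of the Gaussian law the limiting quadratic form, the squared norm of the projection
orthogonal to the unit vector `√p`, is chi-squared with `k - 1` degrees of freedom
(`map_pi_gaussianReal_eq_chiSquared`).

The unconditional convergences follow from the conditional ones by dominated convergence.
-/

noncomputable section

/-! ### The Gamma distribution with large shape -/

instance gammaLaw_isProbabilityMeasure (a : ℝ) : IsProbabilityMeasure (gammaLaw a) := by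
  unfold gammaLaw
  split_ifs with h
  · exact isProbabilityMeasure_gammaMeasure h one_pos
  · infer_instance

lemma integral_gammaMeasure {a : ℝ} (ha : 0 < a) (f : ℝ → ℝ) :
    ∫ x, f x ∂gammaMeasure a 1
      = (Real.Gamma a)⁻¹ * ∫ x in Set.Ioi 0, f x * (x ^ (a - 1) * Real.exp (-x)) := by
  rw [gammaMeasure, integral_withDensity_eq_integral_toReal_smul
    (by unfold gammaPDF; fun_prop) (by simp [gammaPDF])]
  rw [← integral_const_mul, ← integral_indicator measurableSet_Ioi]
  refine integral_congr_ae ?_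
  filter_upwards [Measure.ae_ne volume (0 : ℝ)] with x hx
  rw [gammaPDF, ENNReal.toReal_ofReal (gammaPDFReal_nonneg ha one_pos x)]
  rcases lt_or_gt_of_ne hx with h | h
  · simp [gammaPDFReal, h.not_ge, h.le]
  · simp [gammaPDFReal, h.le, h]
    ring

lemma mgf_gammaMeasure {a s : ℝ} (ha : 0 < a) (hs : s < 1) :
    mgf id (gammaMeasure a 1) s = (1 - s) ^ (-a) := by
  rw [mgf, integral_gammaMeasure ha]
  have h : ∀ x : ℝ, Real.exp (s * id x) * (x ^ (a - 1) * Real.exp (-x))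
      = x ^ (a - 1) * Real.exp (-((1 - s) * x)) := fun x => by
    rw [mul_left_comm, ← Real.exp_add]
    congr 2
    simp only [id]
    ring
  simp_rw [h]
  rw [Real.integral_rpow_mul_exp_neg_mul_Ioi ha (by linarith), mul_comm, mul_assoc,
    mul_inv_cancel₀ (Real.Gamma_pos_of_pos ha).ne', mul_one, one_div,
    Real.inv_rpow (by linarith), Real.rpow_neg (by linarith)]

lemma Iio_subset_integrableExpSet_gammaMeasure {a : ℝ} (ha : 0 < a) :
    Set.Iio 1 ⊆ integrableExpSet id (gammaMeasure a 1) := by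
  intro s hs
  have := isProbabilityMeasure_gammaMeasure ha one_pos
  -- A non-integrable exponential would give the junk value `0` to the moment generating function.
  by_contra h
  have h0 : mgf id (gammaMeasure a 1) s = 0 := mgf_undef h
  rw [mgf_gammaMeasure ha hs] at h0
  exact (Real.rpow_pos_of_pos (sub_pos.2 hs) _).ne' h0

/-- By analytic continuation from the moment generating function on `s < 1`. -/
lemma charFun_gammaMeasure {a : ℝ} (ha : 0 < a) (t : ℝ) :
    charFun (gammaMeasure a 1) t = (1 - t * Complex.I) ^ (-a : ℂ) := by
  let U : Set ℂ := {z | z.re < 1}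
  have hU : IsPreconnected U := (convex_halfSpace_re_lt 1).isPreconnected
  have hUo : IsOpen U := isOpen_lt Complex.continuous_re continuous_const
  have hf : AnalyticOnNhd ℂ (complexMGF id (gammaMeasure a 1)) U := fun z hz =>
    analyticAt_complexMGF (interior_mono (Iio_subset_integrableExpSet_gammaMeasure ha)
      (by rwa [interior_Iio]))
  have hg : AnalyticOnNhd ℂ (fun z : ℂ => (1 - z) ^ (-a : ℂ)) U := by
    refine DifferentiableOn.analyticOnNhd (fun z hz => ?_) hUo
    refine DifferentiableAt.differentiableWithinAt ?_
    have hz' : (1 - z) ∈ Complex.slitPlane := Or.inl (by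
      have : z.re < 1 := hz
      simpa using this)
    exact (by fun_prop : DifferentiableAt ℂ (fun z : ℂ => 1 - z) z).cpow_const hz'
  have key : Set.EqOn (complexMGF id (gammaMeasure a 1)) (fun z : ℂ => (1 - z) ^ (-a : ℂ)) U := by
    refine hf.eqOn_of_preconnected_of_frequently_eq hg hU (z₀ := 0) (by simp [U]) ?_
    have hreal : ∀ s : ℝ, s < 1 → complexMGF id (gammaMeasure a 1) s = (1 - s : ℂ) ^ (-a : ℂ) := by
      intro s hs
      rw [complexMGF_ofReal, mgf_gammaMeasure ha hs, Complex.ofReal_cpow (by linarith)]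
      push_cast
      rfl
    have ht : Tendsto (fun s : ℝ => (s : ℂ)) (𝓝[≠] 0) (𝓝[≠] 0) := by
      refine tendsto_nhdsWithin_iff.2 ⟨?_, ?_⟩
      · exact (Complex.continuous_ofReal.tendsto' 0 0 (by simp)).mono_left nhdsWithin_le_nhds
      · filter_upwards [self_mem_nhdsWithin] with s hs
        simpa using hs
    refine ht.frequently (Eventually.frequently ?_)
    filter_upwards [mem_nhdsWithin_of_mem_nhds (Iio_mem_nhds one_pos)] with s hs
    exact hreal s hs
  rw [← complexMGF_id_mul_I]
  exact key (by simp [U])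

/-- The law of `(Z - a) / √a` for `Z` with Gamma distribution of shape `a`. -/
def standardizedGamma (a : ℝ) : Measure ℝ :=
  (gammaLaw a).map fun x => (x - a) / √a

instance standardizedGamma_isProbabilityMeasure (a : ℝ) :
    IsProbabilityMeasure (standardizedGamma a) :=
  Measure.isProbabilityMeasure_map (by fun_prop)

lemma charFun_standardizedGamma {a : ℝ} (ha : 0 < a) (t : ℝ) :
    charFun (standardizedGamma a) t
      = Complex.exp (-(a * Complex.log (1 + (-(t / √a : ℝ) * Complex.I))) - t * √a * Complex.I) := by
  have h1 : (fun x : ℝ => (x - a) / √a) = (fun x => x + (-√a)) ∘ (fun x => (√a)⁻¹ * x) := by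
    ext x
    have := Real.sqrt_pos.2 ha
    simp only [Function.comp]
    field_simp
    rw [Real.sq_sqrt ha.le]
    ring
  rw [standardizedGamma, gammaLaw, if_pos ha, h1, ← Measure.map_map (by fun_prop) (by fun_prop),
    charFun_map_add_const, charFun_map_mul, charFun_gammaMeasure ha, Complex.cpow_def_of_ne_zero,
    ← Complex.exp_add]
  · congr 1
    simp
    ring_nf
  · intro h
    simpa using congrArg Complex.re h

/-- The second-order expansion of the logarithm gives the limit of the exponent in
`charFun_standardizedGamma`; the remainder is of order `a * a ^ (-3 / 2)`. -/
lemma tendsto_log_taylor_two {t : ℝ} {ι : Type*} {l : Filter ι} {a : ι → ℝ}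
    (ha : Tendsto a l atTop) :
    Tendsto (fun i => -(a i * Complex.log (1 + (-(t / √(a i) : ℝ) * Complex.I)))
      - t * √(a i) * Complex.I) l (𝓝 (-t ^ 2 / 2 : ℂ)) := by
  set z : ι → ℂ := fun i => -(t / √(a i) : ℝ) * Complex.I with hz
  have hnz : ∀ i, ‖z i‖ = |t| / √(a i) := fun i => by
    simp [hz, abs_of_nonneg (Real.sqrt_nonneg _)]
  have hsq : Tendsto (fun i => √(a i)) l atTop := Real.tendsto_sqrt_atTop.comp ha
  have hn0 : Tendsto (fun i => ‖z i‖) l (𝓝 0) := by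
    simp_rw [hnz]
    exact hsq.const_div_atTop _
  have hz0 : Tendsto z l (𝓝 0) := tendsto_zero_iff_norm_tendsto_zero.2 hn0
  have herr : Tendsto (fun i => (a i : ℂ) * (Complex.log (1 + z i) - Complex.logTaylor 3 (z i)))
      l (𝓝 0) := by
    have hO := (Complex.log_sub_logTaylor_isBigO 2).comp_tendsto hz0
    refine ((Asymptotics.isBigO_refl (fun i => (a i : ℂ)) l).mul hO).trans_tendsto ?_
    refine tendsto_zero_iff_norm_tendsto_zero.2 ?_
    have : Tendsto (fun i => t ^ 2 * ‖z i‖) l (𝓝 0) := by simpa using hn0.const_mul (t ^ 2)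
    refine this.congr' ?_
    filter_upwards [ha.eventually_gt_atTop 0] with i hi
    have h2 : ‖z i‖ ^ 2 = t ^ 2 / a i := by
      rw [hnz, div_pow, Real.sq_sqrt hi.le, sq_abs]
    simp only [Function.comp, norm_mul, norm_pow, Complex.norm_real, Real.norm_eq_abs,
      abs_of_pos hi]
    rw [pow_succ ‖z i‖ 2, h2]
    field_simp
  have := herr.const_sub (-t ^ 2 / 2 : ℂ)
  rw [sub_zero] at this
  refine this.congr' ?_
  filter_upwards [ha.eventually_gt_atTop 0] with i hi
  have hs := Real.sqrt_pos.2 hi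
  have haC : (a i : ℂ) = (√(a i) : ℂ) ^ 2 := by
    rw [← Complex.ofReal_pow, Real.sq_sqrt hi.le]
  have hsC : (√(a i) : ℂ) ≠ 0 := by exact_mod_cast hs.ne'
  have h1 : (a i : ℂ) * z i = -(t * √(a i) * Complex.I) := by
    rw [haC]
    simp only [hz]
    push_cast
    field_simp
  have h2 : (a i : ℂ) * z i ^ 2 = -t ^ 2 := by
    rw [haC]
    simp only [hz, mul_pow, Complex.I_sq]
    push_cast
    field_simp
  have h3 : Complex.logTaylor 3 (z i) = z i - z i ^ 2 / 2 := by
    simp [Complex.logTaylor, Finset.sum_range_succ]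
    ring
  change _ = -(a i * Complex.log (1 + z i)) - t * √(a i) * Complex.I
  rw [h3]
  linear_combination h1 - h2 / 2

/-- The central limit theorem for the Gamma distribution, as the shape tends to infinity through
arbitrary real values. -/
lemma tendsto_standardizedGamma {a : ℕ → ℝ} (ha : Tendsto a atTop atTop) :
    Tendsto (β := ProbabilityMeasure ℝ) (fun n => ⟨standardizedGamma (a n), inferInstance⟩) atTop
      (𝓝 ⟨gaussianReal 0 1, inferInstance⟩) := by
  refine ProbabilityMeasure.tendsto_of_tendsto_charFun fun t => ?_
  have h := (Complex.continuous_exp.tendsto _).comp (tendsto_log_taylor_two (t := t) ha)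
  simp only [ProbabilityMeasure.coe_mk, charFun_gaussianReal]
  convert h.congr' ?_ using 2
  · simp [neg_div]
  · filter_upwards [ha.eventually_gt_atTop 0] with n hn
    exact (charFun_standardizedGamma hn t).symm

lemma tendsto_pi_standardizedGamma {k : ℕ} {a : ℕ → Fin k → ℝ}
    (ha : ∀ i, Tendsto (fun n => a n i) atTop atTop) :
    Tendsto (β := ProbabilityMeasure (Fin k → ℝ))
      (fun n => ⟨Measure.pi fun i => standardizedGamma (a n i), inferInstance⟩) atTop
      (𝓝 ⟨Measure.pi fun _ => gaussianReal 0 1, inferInstance⟩) := by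
  have h : Tendsto (β := Fin k → ProbabilityMeasure ℝ)
      (fun n i => ⟨standardizedGamma (a n i), inferInstance⟩) atTop
      (𝓝 fun _ => ⟨gaussianReal 0 1, inferInstance⟩) :=
    (tendsto_pi_nhds (A := fun _ => ProbabilityMeasure ℝ)).2 fun i => tendsto_standardizedGamma (ha i)
  exact (ProbabilityMeasure.continuous_pi.tendsto _).comp h

/-! ### Dirichlet vectors as functions of standardized Gamma variables -/

/-- The normalized vector `(z i / ∑ j, z j)_i` as a function of the standardized coordinates
`w i = (z i - a i) / √(a i)`. -/
def dirichletMap {k : ℕ} (a w : Fin k → ℝ) (i : Fin k) : ℝ :=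
  (a i + √(a i) * w i) / ∑ j, (a j + √(a j) * w j)

@[fun_prop]
lemma measurable_dirichletMap {k : ℕ} (a : Fin k → ℝ) : Measurable (dirichletMap a) := by
  unfold dirichletMap
  fun_prop

instance dirichletLaw_isProbabilityMeasure {k : ℕ} (a : Fin k → ℝ) :
    IsProbabilityMeasure (dirichletLaw a) :=
  Measure.isProbabilityMeasure_map (by fun_prop)

lemma dirichletLaw_eq_map_pi_standardizedGamma {k : ℕ} {a : Fin k → ℝ} (ha : ∀ i, 0 < a i) :
    dirichletLaw a = (Measure.pi fun i => standardizedGamma (a i)).map (dirichletMap a) := by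
  unfold standardizedGamma
  rw [← Measure.pi_map_pi (fun i => by fun_prop), Measure.map_map (by fun_prop) (by fun_prop),
    dirichletLaw]
  congr 1
  ext z i
  have h : ∀ j, a j + √(a j) * ((z j - a j) / √(a j)) = z j := fun j => by
    have := Real.sqrt_pos.2 (ha j)
    field_simp
    ring
  simp [dirichletMap, h]

/-! ### Continuous mapping for a sequence of functions -/

/-- The continuous mapping theorem for a varying sequence of functions: if `ν n` tends weakly to
`ν₀` and `g n` converges continuously to `g₀`, then the images tend weakly. For `G` open,
every point of `g₀ ⁻¹' G` is interior to `⋂ n ≥ N, g n ⁻¹' G` for some `N`, and these interiors increase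
with `N`. -/
lemma tendsto_map_of_tendsto_of_continuousConvergence {E F : Type*}
    [TopologicalSpace E] [MeasurableSpace E] [OpensMeasurableSpace E] [HasOuterApproxClosed E]
    [TopologicalSpace F] [MeasurableSpace F] [BorelSpace F] [HasOuterApproxClosed F]
    {ν : ℕ → ProbabilityMeasure E} {ν₀ : ProbabilityMeasure E} (hν : Tendsto ν atTop (𝓝 ν₀))
    {g : ℕ → E → F} {g₀ : E → F} (hg : ∀ n, Measurable (g n)) (hg₀ : Measurable g₀)
    (h : ∀ x, Tendsto (fun q : ℕ × E => g q.1 q.2) (atTop ×ˢ 𝓝 x) (𝓝 (g₀ x))) :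
    Tendsto (fun n => (ν n).map (hg n).aemeasurable) atTop (𝓝 (ν₀.map hg₀.aemeasurable)) := by
  refine tendsto_of_forall_isOpen_le_liminf_nat' fun G hG => ?_
  simp only [ProbabilityMeasure.toMeasure_map]
  rw [Measure.map_apply hg₀ hG.measurableSet]
  let V : ℕ → Set E := fun N => interior {x | ∀ n, N ≤ n → g n x ∈ G}
  have hV : Monotone V := fun N M hNM =>
    interior_mono fun x hx n hn => hx n (hNM.trans hn)
  have hsub : g₀ ⁻¹' G ⊆ ⋃ N, V N := by
    intro x hx
    have h1 := (h x).eventually (hG.mem_nhds hx)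
    rw [eventually_prod_iff] at h1
    obtain ⟨p, hp, q, hq, hpq⟩ := h1
    obtain ⟨N, hN⟩ := eventually_atTop.1 hp
    refine Set.mem_iUnion.2 ⟨N, mem_interior_iff_mem_nhds.2 ?_⟩
    filter_upwards [hq] with y hy n hn using hpq (hN n hn) hy
  refine (measure_mono hsub).trans ?_
  rw [hV.measure_iUnion]
  refine iSup_le fun N => ?_
  refine (ProbabilityMeasure.le_liminf_measure_open_of_tendsto hν isOpen_interior).trans ?_
  refine liminf_le_liminf ?_
  filter_upwards [eventually_ge_atTop N] with n hn
  rw [Measure.map_apply (hg n) hG.measurableSet]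
  exact measure_mono fun x hx => interior_subset hx n hn

/-! ### A quadratic form in a standard Gaussian vector -/

/-- For a standard Gaussian vector `W` and a unit vector `u`, the squared norm of the component of
`W` orthogonal to `u` has a chi-squared distribution: the standard Gaussian law has the same form in
any orthonormal basis, in particular in one whose first vector is `u`. -/
lemma map_pi_gaussianReal_eq_chiSquared {k : ℕ} (u : Fin k → ℝ) (hu : ∑ i, u i ^ 2 = 1) :
    (Measure.pi fun _ : Fin k => gaussianReal 0 1).map
      (fun w => ∑ i, w i ^ 2 - (∑ i, u i * w i) ^ 2) = chiSquared (k - 1) := by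
  obtain _ | n := k
  · simp at hu
  let U : EuclideanSpace ℝ (Fin (n + 1)) := WithLp.toLp 2 u
  have hU : ‖U‖ = 1 := by
    rw [EuclideanSpace.norm_eq]
    simp [U, hu]
  obtain ⟨b, hb⟩ := Orthonormal.exists_orthonormalBasis_extension_of_card_eq (𝕜 := ℝ) (E := EuclideanSpace ℝ (Fin (n + 1)))
    (ι := Fin (n + 1)) (by simp) (v := fun _ => U) (s := {0}) (by
      refine ⟨fun i => hU, fun i j hij => ?_⟩
      exact absurd (Subsingleton.elim i j) hij)
  have hb0 : b 0 = U := hb 0 rfl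
  let q : EuclideanSpace ℝ (Fin (n + 1)) → ℝ := fun v => ‖v‖ ^ 2 - inner ℝ U v ^ 2
  have hq : Measurable q := by fun_prop
  have h1 : (fun w : Fin (n + 1) → ℝ => ∑ i, w i ^ 2 - (∑ i, u i * w i) ^ 2)
      = q ∘ WithLp.toLp 2 := by
    ext w
    simp [q, U, EuclideanSpace.real_norm_sq_eq, PiLp.inner_apply, mul_comm]
  rw [h1, ← Measure.map_map hq (by fun_prop), map_pi_eq_stdGaussian,
    stdGaussian_eq_map_pi_orthonormalBasis b, Measure.map_map hq (by fun_prop)]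
  have h2 : q ∘ (fun x : Fin (n + 1) → ℝ => ∑ i, x i • b i)
      = (fun z : Fin n → ℝ => ∑ i, z i ^ 2) ∘ (fun x (i : Fin n) => x i.succ) := by
    ext x
    have e1 : ‖∑ i, x i • b i‖ ^ 2 = ∑ i, x i ^ 2 := by
      rw [← real_inner_self_eq_norm_sq, b.orthonormal.inner_sum]
      simp [sq]
    have e2 : inner ℝ U (∑ i, x i • b i) = x 0 := by
      rw [← hb0, b.orthonormal.inner_right_fintype]
    change ‖∑ i, x i • b i‖ ^ 2 - inner ℝ U (∑ i, x i • b i) ^ 2 = ∑ i : Fin n, x i.succ ^ 2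
    rw [e1, e2, Fin.sum_univ_succ]
    ring
  have hm : MeasurePreserving (fun (x : Fin (n + 1) → ℝ) (i : Fin n) => x i.succ)
      (Measure.pi fun _ => gaussianReal 0 1) (Measure.pi fun _ => gaussianReal 0 1) :=
    measurePreserving_snd.comp
      (measurePreserving_piFinSuccAbove (fun _ : Fin (n + 1) => gaussianReal 0 1) 0)
  rw [h2, ← Measure.map_map (by fun_prop) (by fun_prop), hm.map_eq]
  rfl

/-! ### Continuous convergence of the two statistics -/

/-- The chi-squared statistic of two vectors of cell probabilities. -/
def chiSqVec {k : ℕ} (c : ℝ) (p h : Fin k → ℝ) : ℝ :=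
  c * ∑ i, (p i - h i) ^ 2 / h i

/-- The Kullback-Leibler divergence of two vectors of cell probabilities. -/
def klVec {k : ℕ} (p h : Fin k → ℝ) : ℝ :=
  ∑ i, p i * Real.log (p i / h i)

/-- The second-order Taylor expansion of `y log y` at `1`. -/
lemma tendsto_mul_log_taylor_remainder :
    Tendsto (fun x : ℝ => ((1 + x) * Real.log (1 + x) - x - x ^ 2 / 2) / x ^ 2) (𝓝 0) (𝓝 0) := by
  have hb : Tendsto (fun x : ℝ => (5 : ℝ) * |x|) (𝓝 0) (𝓝 0) := by
    have : Continuous fun x : ℝ => (5 : ℝ) * |x| := by fun_prop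
    exact this.tendsto' 0 0 (by simp)
  refine squeeze_zero_norm' ?_ hb
  filter_upwards [Metric.ball_mem_nhds (0 : ℝ) (by norm_num : (0 : ℝ) < 1 / 2)] with x hx
  have hx' : |x| < 1 / 2 := by simpa using hx
  obtain rfl | hx0 := eq_or_ne x 0
  · simp
  have hpos : 0 < |x| := abs_pos.2 hx0
  have h1 := Real.abs_log_sub_add_sum_range_le (x := -x) (by rw [abs_neg]; linarith) 2
  set r := Real.log (1 + x) - x + x ^ 2 / 2 with hr
  have h2 : |r| ≤ 2 * |x| ^ 3 := by
    have e : (∑ i ∈ Finset.range 2, (-x) ^ (i + 1) / ((i : ℝ) + 1)) + Real.log (1 - -x) = r := by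
      simp [Finset.sum_range_succ, hr]
      ring
    rw [e, abs_neg] at h1
    refine h1.trans ?_
    rw [div_le_iff₀ (by linarith)]
    have h3 : 0 < |x| ^ 3 := by positivity
    norm_num
    nlinarith
  have h3 : (1 + x) * Real.log (1 + x) - x - x ^ 2 / 2 = (1 + x) * r - x ^ 3 / 2 := by
    rw [hr]; ring
  rw [h3, Real.norm_eq_abs, abs_div, abs_of_nonneg (sq_nonneg x), div_le_iff₀ (by positivity)]
  have h4 : |1 + x| ≤ 3 / 2 := by
    rw [abs_le] at *
    constructor <;> linarith [abs_lt.1 hx']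
  calc |(1 + x) * r - x ^ 3 / 2| ≤ |(1 + x) * r| + |x ^ 3 / 2| := abs_sub _ _
    _ = |1 + x| * |r| + |x| ^ 3 / 2 := by rw [abs_mul, abs_div, abs_pow]; simp
    _ ≤ 3 / 2 * (2 * |x| ^ 3) + |x| ^ 3 / 2 := by gcongr
    _ ≤ 5 * |x| * x ^ 2 := by
      rw [← sq_abs x]
      nlinarith [pow_pos hpos 3]

variable {ι : Type*} {l : Filter ι} {k : ℕ}

/-- The chi-squared statistic in terms of the rescaled relative deviations
`√c (P i - h i) / h i`. -/
lemma chiSqVec_eq_sum {c : ℝ} (hc : 0 < c) {P h : Fin k → ℝ} (hh : ∀ i, 0 < h i) :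
    chiSqVec c P h = ∑ i, h i * (√c * (P i - h i) / h i) ^ 2 := by
  rw [chiSqVec, Finset.mul_sum]
  refine Finset.sum_congr rfl fun i _ => ?_
  have := (hh i).ne'
  rw [div_pow, mul_pow, Real.sq_sqrt hc.le]
  field_simp

/-- Twice the rescaled Kullback-Leibler divergence and the chi-squared statistic are asymptotically
equivalent when the deviations of the cell probabilities are of order `1 / √c`: the first-order
terms cancel because both vectors sum to `1`, and the second-order term is the statistic. -/
lemma tendsto_klVec_sub_chiSqVec {c : ι → ℝ} (hc : Tendsto c l atTop) {P h : ι → Fin k → ℝ}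
    {p d : Fin k → ℝ} (hp : ∀ i, 0 < p i) (hh : ∀ i, Tendsto (fun n => h n i) l (𝓝 (p i)))
    (hsum : ∀ᶠ n in l, ∑ i, P n i = ∑ i, h n i)
    (hd : ∀ i, Tendsto (fun n => √(c n) * (P n i - h n i) / h n i) l (𝓝 (d i))) :
    Tendsto (fun n => 2 * c n * klVec (P n) (h n) - chiSqVec (c n) (P n) (h n)) l (𝓝 0) := by
  -- `v` is the rescaled deviation, so that `P = h (1 + v / √c)`, and `ψ` is the relative remainder of
  -- the Taylor expansion; each summand of the difference is `2 h v² ψ(v / √c)`, up to first order terms.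
  set v : ι → Fin k → ℝ := fun n i => √(c n) * (P n i - h n i) / h n i with hv
  set ψ : ℝ → ℝ := fun x => ((1 + x) * Real.log (1 + x) - x - x ^ 2 / 2) / x ^ 2 with hψ
  have hsq : Tendsto (fun n => √(c n)) l atTop := Real.tendsto_sqrt_atTop.comp hc
  have hx : ∀ i, Tendsto (fun n => v n i / √(c n)) l (𝓝 0) := fun i => (hd i).div_atTop hsq
  have hlim : Tendsto (fun n => ∑ i, 2 * (h n i * v n i ^ 2 * ψ (v n i / √(c n)))) l (𝓝 0) := by
    have : Tendsto (fun n => ∑ i, 2 * (h n i * v n i ^ 2 * ψ (v n i / √(c n)))) l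
        (𝓝 (∑ i, 2 * (p i * d i ^ 2 * 0))) :=
      tendsto_finsetSum _ fun i _ => (((hh i).mul ((hd i).pow 2)).mul
        (tendsto_mul_log_taylor_remainder.comp (hx i))).const_mul 2
    simpa using this
  refine hlim.congr' ?_
  have hpos : ∀ᶠ n in l, ∀ i, 0 < h n i :=
    eventually_all.2 fun i => (hh i).eventually (lt_mem_nhds (hp i))
  filter_upwards [hc.eventually_gt_atTop 0, hpos, hsum] with n hcn hhn hsn
  have hs := Real.sqrt_pos.2 hcn
  have hzero : ∑ i, 2 * c n * (P n i - h n i) = 0 := by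
    rw [← Finset.mul_sum, Finset.sum_sub_distrib, hsn, sub_self, mul_zero]
  rw [← sub_zero (2 * c n * klVec (P n) (h n)), ← hzero, klVec, chiSqVec, Finset.mul_sum,
    Finset.mul_sum, ← Finset.sum_sub_distrib, ← Finset.sum_sub_distrib]
  refine Finset.sum_congr rfl fun i _ => ?_
  have hhi := (hhn i).ne'
  set x := v n i / √(c n) with hxdef
  have hxv : x = (P n i - h n i) / h n i := by
    simp only [hxdef, hv]
    field_simp
  have hP : P n i = h n i * (1 + x) := by
    rw [hxv]
    field_simp
    ring
  have hvx : v n i ^ 2 = c n * x ^ 2 := by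
    rw [hxdef, div_pow (v n i) √(c n), Real.sq_sqrt hcn.le, mul_div_cancel₀ _ hcn.ne']
  have hψx : x ^ 2 * ψ x = (1 + x) * Real.log (1 + x) - x - x ^ 2 / 2 := by
    obtain h0 | h0 := eq_or_ne x 0
    · simp [h0]
    · simp only [hψ]
      field_simp
  have hratio : P n i / h n i = 1 + x := by
    rw [hP]
    field_simp
  have hdev : (P n i - h n i) ^ 2 / h n i = h n i * x ^ 2 := by
    rw [hP]
    field_simp
    ring
  rw [hratio, hdev, hvx, hP]
  linear_combination 2 * h n i * c n * hψx

/-- The rescaled relative deviations of the normalized vector `dirichletMap a w` from the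
normalized parameters `a i / c`. -/
lemma tendsto_dirichletMap_deviation {c : ι → ℝ} (hc : Tendsto c l atTop) {a w : ι → Fin k → ℝ}
    (hac : ∀ n, ∑ i, a n i = c n) {p w₀ : Fin k → ℝ} (hp : ∀ i, 0 < p i)
    (ha : ∀ i, Tendsto (fun n => a n i / c n) l (𝓝 (p i)))
    (hw : ∀ i, Tendsto (fun n => w n i) l (𝓝 (w₀ i))) :
    (∀ᶠ n in l, ∑ i, dirichletMap (a n) (w n) i = ∑ i, a n i / c n) ∧
    ∀ i, Tendsto (fun n => √(c n) * (dirichletMap (a n) (w n) i - a n i / c n) / (a n i / c n)) l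
      (𝓝 (w₀ i / √(p i) - ∑ j, √(p j) * w₀ j)) := by
  have hsq : Tendsto (fun n => √(c n)) l atTop := Real.tendsto_sqrt_atTop.comp hc
  have hrt : ∀ i, Tendsto (fun n => √(a n i / c n)) l (𝓝 √(p i)) := fun i =>
    (Real.continuous_sqrt.tendsto _).comp (ha i)
  -- The normalizing sum is `c (1 + L / √c)`.
  set L : ι → ℝ := fun n => ∑ j, √(a n j / c n) * w n j with hL
  have hLlim : Tendsto L l (𝓝 (∑ j, √(p j) * w₀ j)) :=
    tendsto_finsetSum _ fun j _ => (hrt j).mul (hw j)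
  have hT : Tendsto (fun n => 1 + L n / √(c n)) l (𝓝 1) := by
    simpa using (hLlim.div_atTop hsq).const_add 1
  have hpos : ∀ᶠ n in l, ∀ i, 0 < a n i / c n :=
    eventually_all.2 fun i => (ha i).eventually (lt_mem_nhds (hp i))
  have hS : ∀ n, 0 < c n → ∑ j, (a n j + √(a n j) * w n j) = c n * (1 + L n / √(c n)) := by
    intro n hcn
    have hs := Real.sqrt_pos.2 hcn
    have e : ∀ j, √(a n j) = √(c n) * √(a n j / c n) := fun j => by
      rw [← Real.sqrt_mul hcn.le, mul_div_cancel₀ _ hcn.ne']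
    have e2 : c n * (1 + L n / √(c n)) = c n + √(c n) * L n := by
      nth_rewrite 1 [← Real.sq_sqrt hcn.le]
      nth_rewrite 3 [← Real.sq_sqrt hcn.le]
      field_simp
    rw [e2, Finset.sum_add_distrib, hac, hL, Finset.mul_sum]
    congr 1
    refine Finset.sum_congr rfl fun j _ => ?_
    rw [e j]
    ring
  constructor
  · filter_upwards [hc.eventually_gt_atTop 0, hT.eventually (lt_mem_nhds one_pos)] with n hcn hTn
    have hTn' : 0 < 1 + L n / √(c n) := hTn
    simp only [dirichletMap]
    rw [← Finset.sum_div, ← Finset.sum_div, hac, div_self hcn.ne', div_self]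
    rw [hS n hcn]
    positivity
  · intro i
    have hlim : Tendsto (fun n => (w n i / √(a n i / c n) - L n) / (1 + L n / √(c n))) l
        (𝓝 (w₀ i / √(p i) - ∑ j, √(p j) * w₀ j)) := by
      have := (((hw i).div (hrt i) (Real.sqrt_pos.2 (hp i)).ne').sub hLlim).div hT one_ne_zero
      rw [div_one] at this
      exact this
    refine hlim.congr' ?_
    filter_upwards [hc.eventually_gt_atTop 0, hT.eventually (lt_mem_nhds one_pos), hpos]
      with n hcn hTn hhn
    have hTn' : 0 < 1 + L n / √(c n) := hTn
    have key : ∀ s r x y : ℝ, 0 < s → 0 < r → 0 < 1 + y / s → (x / r - y) / (1 + y / s)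
        = s * ((s ^ 2 * r ^ 2 + s * r * x) / (s ^ 2 * (1 + y / s)) - s ^ 2 * r ^ 2 / s ^ 2)
          / (s ^ 2 * r ^ 2 / s ^ 2) := by
      intro s r x y hs hr hy
      have hy' : 1 + y / s = (s + y) / s := by field_simp
      have hsy : s + y ≠ 0 := by
        intro h0
        simp [hy', h0] at hy
      rw [hy']
      field_simp
      ring
    have hkey := key √(c n) √(a n i / c n) (w n i) (L n) (Real.sqrt_pos.2 hcn)
      (Real.sqrt_pos.2 (hhn i)) hTn'
    have e : √(c n) * √(a n i / c n) = √(a n i) := by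
      rw [← Real.sqrt_mul hcn.le, mul_div_cancel₀ _ hcn.ne']
    rw [Real.sq_sqrt hcn.le, Real.sq_sqrt (hhn i).le, mul_div_cancel₀ _ hcn.ne', e] at hkey
    rw [dirichletMap, hS n hcn]
    exact hkey

/-- The quadratic form to which the chi-squared statistic converges. -/
lemma sum_mul_deviation_sq {p w : Fin k → ℝ} (hp : ∀ i, 0 < p i) (hsum : ∑ i, p i = 1) :
    ∑ i, p i * (w i / √(p i) - ∑ j, √(p j) * w j) ^ 2
      = ∑ i, w i ^ 2 - (∑ i, √(p i) * w i) ^ 2 := by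
  set L := ∑ j, √(p j) * w j with hL
  have h : ∀ i, p i * (w i / √(p i) - L) ^ 2
      = w i ^ 2 - 2 * L * (√(p i) * w i) + p i * L ^ 2 := fun i => by
    have hs := Real.sqrt_pos.2 (hp i)
    have hsq := Real.sq_sqrt (hp i).le
    generalize √(p i) = r at *
    rw [← hsq]
    field_simp
    ring
  simp_rw [h]
  rw [Finset.sum_add_distrib, Finset.sum_sub_distrib, ← Finset.mul_sum, ← Finset.sum_mul, hsum,
    ← hL]
  ring

lemma tendsto_chiSqVec {c : ι → ℝ} (hc : Tendsto c l atTop) {P h : ι → Fin k → ℝ}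
    {p d : Fin k → ℝ} (hp : ∀ i, 0 < p i) (hh : ∀ i, Tendsto (fun n => h n i) l (𝓝 (p i)))
    (hd : ∀ i, Tendsto (fun n => √(c n) * (P n i - h n i) / h n i) l (𝓝 (d i))) :
    Tendsto (fun n => chiSqVec (c n) (P n) (h n)) l (𝓝 (∑ i, p i * d i ^ 2)) := by
  have hlim := tendsto_finsetSum Finset.univ fun i _ => (hh i).mul ((hd i).pow 2)
  refine hlim.congr' ?_
  have hpos : ∀ᶠ n in l, ∀ i, 0 < h n i :=
    eventually_all.2 fun i => (hh i).eventually (lt_mem_nhds (hp i))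
  filter_upwards [hc.eventually_gt_atTop 0, hpos] with n hcn hhn
  exact (chiSqVec_eq_sum hcn hhn).symm

/-! ### Limit laws under Dirichlet distributions -/

lemma tendsto_map_dirichletLaw {k : ℕ} {a : ℕ → Fin k → ℝ}
    (ha : ∀ i, Tendsto (fun n => a n i) atTop atTop) {g : ℕ → (Fin k → ℝ) → ℝ}
    {g₀ : (Fin k → ℝ) → ℝ} (hg : ∀ n, Measurable (g n)) (hg₀ : Measurable g₀)
    (h : ∀ w₀, Tendsto (fun q : ℕ × (Fin k → ℝ) => g q.1 (dirichletMap (a q.1) q.2))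
      (atTop ×ˢ 𝓝 w₀) (𝓝 (g₀ w₀))) :
    Tendsto (β := ProbabilityMeasure ℝ)
      (fun n => ⟨(dirichletLaw (a n)).map (g n),
        Measure.isProbabilityMeasure_map (hg n).aemeasurable⟩) atTop
      (𝓝 ⟨(Measure.pi fun _ : Fin k => gaussianReal 0 1).map g₀,
        Measure.isProbabilityMeasure_map hg₀.aemeasurable⟩) := by
  have hlim := tendsto_map_of_tendsto_of_continuousConvergence (tendsto_pi_standardizedGamma ha)
    (g := fun n w => g n (dirichletMap (a n) w)) (fun n => (hg n).comp (by fun_prop)) hg₀ h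
  refine hlim.congr' ?_
  have hpos : ∀ᶠ n in atTop, ∀ i, 0 < a n i :=
    eventually_all.2 fun i => (ha i).eventually_gt_atTop 0
  filter_upwards [hpos] with n hn
  refine Subtype.ext ?_
  change (Measure.pi fun i => standardizedGamma (a n i)).map (g n ∘ dirichletMap (a n)) = _
  rw [← Measure.map_map (hg n) (by fun_prop), ← dirichletLaw_eq_map_pi_standardizedGamma hn]

@[fun_prop]
lemma measurable_chiSqVec {k : ℕ} (c : ℝ) :
    Measurable fun q : (Fin k → ℝ) × (Fin k → ℝ) => chiSqVec c q.1 q.2 := by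
  unfold chiSqVec
  fun_prop

@[fun_prop]
lemma measurable_klVec {k : ℕ} :
    Measurable fun q : (Fin k → ℝ) × (Fin k → ℝ) => klVec q.1 q.2 := by
  unfold klVec
  fun_prop

section DirichletLimits

variable {k : ℕ} {c : ℕ → ℝ} (hc : Tendsto c atTop atTop) {h : ℕ → Fin k → ℝ} {p : Fin k → ℝ}
  (hp : ∀ i, 0 < p i) (hh : ∀ i, Tendsto (fun n => h n i) atTop (𝓝 (p i)))
  (hc0 : ∀ n, 0 < c n) (hsum : ∀ n, ∑ i, h n i = 1)

include hc hp hh hc0 hsum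

/-- `tendsto_dirichletMap_deviation` along the filter of continuous convergence at `w₀`, with
parameters `c * h`. -/
lemma dirichlet_deviation_of_tendsto (w₀ : Fin k → ℝ) :
    (∀ᶠ q : ℕ × (Fin k → ℝ) in atTop ×ˢ 𝓝 w₀,
      ∑ i, dirichletMap (fun i => c q.1 * h q.1 i) q.2 i = ∑ i, h q.1 i) ∧
    ∀ i, Tendsto (fun q : ℕ × (Fin k → ℝ) => √(c q.1) *
        (dirichletMap (fun i => c q.1 * h q.1 i) q.2 i - h q.1 i) / h q.1 i)
      (atTop ×ˢ 𝓝 w₀) (𝓝 (w₀ i / √(p i) - ∑ j, √(p j) * w₀ j)) := by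
  have hdiv : ∀ n i, c n * h n i / c n = h n i := fun n i => mul_div_cancel_left₀ _ (hc0 n).ne'
  have := tendsto_dirichletMap_deviation (l := atTop ×ˢ 𝓝 w₀) (c := fun q => c q.1)
    (hc.comp tendsto_fst) (a := fun q i => c q.1 * h q.1 i) (w := fun q => q.2)
    (fun q => by rw [← Finset.mul_sum, hsum, mul_one]) hp
    (fun i => by simpa only [hdiv, Function.comp_def] using (hh i).comp tendsto_fst)
    (fun i => (tendsto_pi_nhds.1 tendsto_snd i))
  simpa only [hdiv] using this

lemma tendsto_dirichletLaw_chiSqVec :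
    Tendsto (β := ProbabilityMeasure ℝ)
      (fun n => ⟨(dirichletLaw fun i => c n * h n i).map fun x => chiSqVec (c n) x (h n),
        Measure.isProbabilityMeasure_map (by fun_prop)⟩) atTop
      (𝓝 ⟨chiSquared (k - 1), inferInstance⟩) := by
  have hp1 : ∑ i, p i = 1 := by
    refine tendsto_nhds_unique (tendsto_finsetSum Finset.univ fun i _ => hh i) ?_
    simp only [hsum]
    exact tendsto_const_nhds
  have ha : ∀ i, Tendsto (fun n => c n * h n i) atTop atTop := fun i =>
    hc.atTop_mul_pos (hp i) (hh i)
  have hlim := tendsto_map_dirichletLaw ha (g := fun n x => chiSqVec (c n) x (h n))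
    (g₀ := fun w => ∑ i, w i ^ 2 - (∑ i, √(p i) * w i) ^ 2) (fun n => by fun_prop)
    (by fun_prop) (fun w₀ => by
      rw [← sum_mul_deviation_sq hp hp1]
      exact tendsto_chiSqVec (hc.comp tendsto_fst) hp (fun i => (hh i).comp tendsto_fst)
        (dirichlet_deviation_of_tendsto hc hp hh hc0 hsum w₀).2)
  convert hlim using 2
  refine congrArg 𝓝 (Subtype.ext (map_pi_gaussianReal_eq_chiSquared (fun i => √(p i)) ?_).symm)
  simpa only [Real.sq_sqrt (hp _).le] using hp1

lemma tendsto_dirichletLaw_klVec_sub_chiSqVec {ε : ℝ} (hε : 0 < ε) :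
    Tendsto (fun n => (dirichletLaw fun i => c n * h n i)
      {x | ε ≤ |2 * c n * klVec x (h n) - chiSqVec (c n) x (h n)|}) atTop (𝓝 0) := by
  have ha : ∀ i, Tendsto (fun n => c n * h n i) atTop atTop := fun i =>
    hc.atTop_mul_pos (hp i) (hh i)
  have hm : ∀ n, Measurable fun x => 2 * c n * klVec x (h n) - chiSqVec (c n) x (h n) := fun n => by
    fun_prop
  have hlim := tendsto_map_dirichletLaw ha
    (g := fun n x => 2 * c n * klVec x (h n) - chiSqVec (c n) x (h n))
    (g₀ := fun _ => 0) hm measurable_const (fun w₀ => by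
      obtain ⟨h1, h2⟩ := dirichlet_deviation_of_tendsto hc hp hh hc0 hsum w₀
      exact tendsto_klVec_sub_chiSqVec (hc.comp tendsto_fst) hp
        (fun i => (hh i).comp tendsto_fst) h1 h2)
  have hF : IsClosed {y : ℝ | ε ≤ |y|} := isClosed_le continuous_const continuous_abs
  have hle := ProbabilityMeasure.limsup_measure_closed_le_of_tendsto hlim hF
  simp only [ProbabilityMeasure.coe_mk] at hle
  rw [Measure.map_const, Measure.smul_apply, Measure.dirac_apply' _ hF.measurableSet] at hle
  simp only [Set.indicator_apply, Set.mem_ofPred_eq, abs_zero, hε.not_ge, if_false, smul_zero]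
    at hle
  simp_rw [Measure.map_apply (hm _) hF.measurableSet] at hle
  exact tendsto_of_le_liminf_of_limsup_le (zero_le) hle

end DirichletLimits

/-! ### Cell masses under a Dirichlet process -/

section Partition

variable {S : Type*} [MeasurableSpace S] {k : ℕ} {A : Fin k → Set S}

lemma IsMeasurablePartition.sum_measureReal (hA : IsMeasurablePartition A) (G : Measure S)
    [IsProbabilityMeasure G] : ∑ i, G.real (A i) = 1 := by
  rw [← measureReal_iUnion_fintype hA.disjoint hA.measurableSet, hA.iUnion_eq, probReal_univ]

@[fun_prop]
lemma measurable_probabilityMeasure_real {B : Set S} (hB : MeasurableSet B) :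
    Measurable fun P : ProbabilityMeasure S => (P : Measure S).real B :=
  ((Measure.measurable_coe hB).comp measurable_subtype_coe).ennreal_toReal

lemma dirichletLaw_fin_one {c : ℝ} (hc : 0 < c) :
    dirichletLaw (fun _ : Fin 1 => c) = Measure.dirac fun _ => 1 := by
  have h : ∀ᵐ z ∂(Measure.pi fun _ : Fin 1 => gammaLaw c), z 0 ≠ 0 := by
    have h0 : ∀ᵐ x ∂gammaLaw c, x ≠ 0 := by
      rw [gammaLaw, if_pos hc, gammaMeasure]
      exact (withDensity_absolutelyContinuous _ _).ae_le (Measure.ae_ne volume 0)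
    exact (Measure.tendsto_eval_ae_ae (μ := fun _ : Fin 1 => gammaLaw c) (i := 0)).eventually h0
  rw [dirichletLaw, Measure.map_congr (g := fun _ _ => (1 : ℝ))]
  · simp
  · filter_upwards [h] with z hz
    ext i
    rw [Subsingleton.elim i 0]
    simp [div_self hz]

/-- The masses of the cells under a Dirichlet process have a Dirichlet distribution also for the
trivial partition, which `IsDirichletProcess` leaves out: both laws are then concentrated at `1`. -/
lemma IsDirichletProcess.map_eq {Q : Measure (ProbabilityMeasure S)} [IsProbabilityMeasure Q]
    {c : ℝ} {G : Measure S} [IsProbabilityMeasure G] (hQ : IsDirichletProcess Q c G) (hc : 0 < c)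
    (hA : IsMeasurablePartition A) :
    Q.map (fun (P : ProbabilityMeasure S) (i : Fin k) => (P : Measure S).real (A i))
      = dirichletLaw fun i => c * G.real (A i) := by
  obtain hk | hk := le_or_gt 2 k
  · exact hQ k A hk hA
  · interval_cases k
    · simpa using hA.sum_measureReal G
    · have h : ∀ (G : Measure S) [IsProbabilityMeasure G] (i : Fin 1), G.real (A i) = 1 := by
        intro G _ i
        rw [Subsingleton.elim i 0]
        simpa using hA.sum_measureReal G
      simp only [h, mul_one, dirichletLaw_fin_one hc]
      simp

end Partition

/-! ### The posterior base distribution -/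

section PosteriorBase

variable {S : Type*} [MeasurableSpace S]

instance posteriorBase_isFiniteMeasure (α : ℝ) (H : Measure S) [IsFiniteMeasure H] {m : ℕ}
    (x : Fin m → S) : IsFiniteMeasure (posteriorBase α H x) := by
  have : IsFiniteMeasure (empiricalMeasure x) := by
    unfold empiricalMeasure
    obtain _ | m := m
    · simp only [Finset.univ_eq_empty, Finset.sum_empty, smul_zero]
      infer_instance
    · exact Measure.smul_finite _ (by simp)
  unfold posteriorBase
  have := Measure.smul_finite H (ENNReal.ofReal_ne_top (r := α / (α + m)))
  have := Measure.smul_finite (empiricalMeasure x) (ENNReal.ofReal_ne_top (r := m / (α + m)))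
  infer_instance

lemma posteriorBase_real {α : ℝ} (hα : 0 < α) (H : Measure S) [IsFiniteMeasure H] {m : ℕ}
    (x : Fin m → S) {B : Set S} (hB : MeasurableSet B) :
    (posteriorBase α H x).real B = α / (α + m) * H.real B
      + m / (α + m) * ((m : ℝ)⁻¹ * ∑ i, B.indicator (fun _ => (1 : ℝ)) (x i)) := by
  have h : ∀ i, B.indicator (1 : S → ℝ≥0∞) (x i) ≠ ∞ := fun i => by
    by_cases hi : x i ∈ B <;> simp [hi]
  have hsum : (∑ i, B.indicator (1 : S → ℝ≥0∞) (x i)).toReal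
      = ∑ i, B.indicator (fun _ => (1 : ℝ)) (x i) := by
    rw [ENNReal.toReal_sum fun i _ => h i]
    refine Finset.sum_congr rfl fun i _ => ?_
    by_cases hi : x i ∈ B <;> simp [hi]
  obtain rfl | hm := Nat.eq_zero_or_pos m
  · simp [posteriorBase, measureReal_def, hα.ne']
  have hfin : ENNReal.ofReal (m / (α + m)) * ((m : ℝ≥0∞)⁻¹ * ∑ i, B.indicator (1 : S → ℝ≥0∞) (x i))
      ≠ ∞ := by
    refine ENNReal.mul_ne_top ENNReal.ofReal_ne_top (ENNReal.mul_ne_top ?_ ?_)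
    · simp [hm.ne']
    · exact (ENNReal.sum_lt_top.2 fun i _ => (h i).lt_top).ne
  simp only [posteriorBase, empiricalMeasure, measureReal_def, Measure.add_apply,
    Measure.smul_apply, Measure.finsetSum_apply, Measure.dirac_apply' _ hB, smul_eq_mul]
  rw [ENNReal.toReal_add (ENNReal.mul_ne_top ENNReal.ofReal_ne_top (measure_ne_top _ _)) hfin,
    ENNReal.toReal_mul, ENNReal.toReal_mul, ENNReal.toReal_mul, hsum,
    ENNReal.toReal_ofReal (by positivity), ENNReal.toReal_ofReal (by positivity),
    ENNReal.toReal_inv, ENNReal.toReal_natCast]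

lemma isProbabilityMeasure_posteriorBase {α : ℝ} (hα : 0 < α) (H : Measure S)
    [IsProbabilityMeasure H] {m : ℕ} (x : Fin m → S) :
    IsProbabilityMeasure (posteriorBase α H x) := by
  rw [isProbabilityMeasure_iff_real, posteriorBase_real hα H x MeasurableSet.univ]
  obtain rfl | hm := Nat.eq_zero_or_pos m
  · simp [hα.ne']
  · simp
    field_simp

lemma measurable_posteriorBase_real {α : ℝ} (hα : 0 < α) (H : Measure S) [IsFiniteMeasure H]
    {m : ℕ} {B : Set S} (hB : MeasurableSet B) :
    Measurable fun x : Fin m → S => (posteriorBase α H x).real B := by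
  simp_rw [posteriorBase_real hα H _ hB]
  have : Measurable (B.indicator fun _ => (1 : ℝ)) := measurable_const.indicator hB
  fun_prop

/-- By the strong law of large numbers, the base distribution of the posterior gives a measurable
set asymptotically its true probability. -/
lemma ae_tendsto_posteriorBase_real {Ω : Type*} [MeasurableSpace Ω] {μ : Measure Ω}
    [IsProbabilityMeasure μ] {F H : Measure S} [IsProbabilityMeasure H] {α : ℝ} (hα : 0 < α)
    {X : ℕ → Ω → S} (hX_law : ∀ n, HasLaw (X n) F μ) (hX_indep : iIndepFun X μ) {B : Set S}
    (hB : MeasurableSet B) :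
    ∀ᵐ ω ∂μ, Tendsto (fun m : ℕ => (posteriorBase α H fun i : Fin m => X i ω).real B) atTop
      (𝓝 (F.real B)) := by
  have hφ : Measurable (B.indicator fun _ => (1 : ℝ)) := measurable_const.indicator hB
  have hid : ∀ n, IdentDistrib (fun ω => B.indicator (fun _ => (1 : ℝ)) (X n ω))
      (fun ω => B.indicator (fun _ => (1 : ℝ)) (X 0 ω)) μ μ := fun n =>
    ((hX_law n).identDistrib (hX_law 0)).comp hφ
  have hint : Integrable (fun ω => B.indicator (fun _ => (1 : ℝ)) (X 0 ω)) μ := by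
    refine Integrable.of_bound (hφ.comp_aemeasurable (hX_law 0).aemeasurable).aestronglyMeasurable
      1 (ae_of_all _ fun ω => ?_)
    by_cases h : X 0 ω ∈ B <;> simp [h]
  have hmean : ∫ ω, B.indicator (fun _ => (1 : ℝ)) (X 0 ω) ∂μ = F.real B := by
    rw [← (hX_law 0).map_eq, ← integral_indicator_one hB,
      integral_map (hX_law 0).aemeasurable (measurable_one.indicator hB).aestronglyMeasurable]
    rfl
  have hslln := strong_law_ae_real (μ := μ) (fun n ω => B.indicator (fun _ => (1 : ℝ)) (X n ω)) hint
    (fun i j hij => (hX_indep.indepFun hij).comp hφ hφ) hid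
  filter_upwards [hslln] with ω hω
  rw [hmean] at hω
  have hm : Tendsto (fun m : ℕ => (m : ℝ)) atTop atTop := tendsto_natCast_atTop_atTop
  have h1 : Tendsto (fun m : ℕ => α / (α + m)) atTop (𝓝 0) :=
    (tendsto_atTop_add_const_left _ α hm).const_div_atTop α
  have h2 : Tendsto (fun m : ℕ => (m : ℝ) / (α + m)) atTop (𝓝 1) := by
    have := h1.const_sub 1
    rw [sub_zero] at this
    refine this.congr fun m => ?_
    have : α + m ≠ 0 := by positivity
    field_simp
    ring
  have := (h1.mul_const (H.real B)).add (h2.mul hω)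
  rw [zero_mul, one_mul, zero_add] at this
  refine this.congr fun m => ?_
  rw [posteriorBase_real hα H _ hB,
    Fin.sum_univ_eq_sum_range fun i => B.indicator (fun _ => (1 : ℝ)) (X i ω), inv_mul_eq_div]

end PosteriorBase

/-! ### From conditional to unconditional limits -/

section Conditional

variable {Ω 𝓧 𝓨 : Type*} [MeasurableSpace Ω] [MeasurableSpace 𝓧] [MeasurableSpace 𝓨]
  {μ : Measure Ω} [IsProbabilityMeasure μ]

/-- Disintegration of the joint law of `X` and `Y`. -/
lemma lintegral_of_hasCondDistrib {X : Ω → 𝓧} {Y : Ω → 𝓨} {κ : Kernel 𝓧 𝓨} [IsMarkovKernel κ]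
    (h : HasCondDistrib Y X κ μ) {f : 𝓧 × 𝓨 → ℝ≥0∞} (hf : Measurable f) :
    ∫⁻ ω, f (X ω, Y ω) ∂μ = ∫⁻ ω, ∫⁻ y, f (X ω, y) ∂κ (X ω) ∂μ := by
  rw [← lintegral_map' (f := f) hf.aemeasurable h.aemeasurable, h.map_eq,
    Measure.lintegral_compProd hf,
    lintegral_map' (hf.lintegral_kernel_prod_right').aemeasurable h.aemeasurable_fst]

end Conditional

lemma tendstoInDistribution_id_of_map_eq {Ω : ℕ → Type*} [∀ m, MeasurableSpace (Ω m)]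
    {μ : ∀ m, Measure (Ω m)} [∀ m, IsProbabilityMeasure (μ m)] {X : ∀ m, Ω m → ℝ}
    (hX : ∀ m, Measurable (X m)) {ρ : ℕ → ProbabilityMeasure ℝ} {ν : Measure ℝ}
    [IsProbabilityMeasure ν] (hρ : ∀ m, (μ m).map (X m) = ρ m)
    (hlim : Tendsto ρ atTop (𝓝 ⟨ν, inferInstance⟩)) :
    TendstoInDistribution X atTop (id : ℝ → ℝ) μ ν where
  forall_aemeasurable m := (hX m).aemeasurable
  aemeasurable_limit := aemeasurable_id
  tendsto := by
    have e : (⟨ν, inferInstance⟩ : ProbabilityMeasure ℝ)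
        = ⟨ν.map id, Measure.isProbabilityMeasure_map aemeasurable_id⟩ :=
      Subtype.ext Measure.map_id.symm
    rw [e] at hlim
    exact hlim.congr fun m => Subtype.ext (hρ m).symm

section ConditionalLimits

variable {Ω 𝓨 : Type*} {𝓧 : ℕ → Type*} [MeasurableSpace Ω] [∀ m, MeasurableSpace (𝓧 m)]
  [MeasurableSpace 𝓨] {μ : Measure Ω} [IsProbabilityMeasure μ] {X : ∀ m, Ω → 𝓧 m}
  {Y : ℕ → Ω → 𝓨} {κ : ∀ m, Kernel (𝓧 m) 𝓨} [∀ m, IsMarkovKernel (κ m)]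

/-- Convergence in probability to zero under almost every conditional law implies convergence in
probability to zero, by dominated convergence. -/
lemma tendstoInMeasure_zero_of_condDistrib (h : ∀ m, HasCondDistrib (Y m) (X m) (κ m) μ)
    {f : ∀ m, 𝓧 m × 𝓨 → ℝ} (hf : ∀ m, Measurable (f m))
    (hlim : ∀ᵐ ω ∂μ, ∀ ε : ℝ, 0 < ε →
      Tendsto (fun m => κ m (X m ω) {y | ε ≤ |f m (X m ω, y)|}) atTop (𝓝 0)) :
    TendstoInMeasure μ (fun m ω => f m (X m ω, Y m ω)) atTop (fun _ => (0 : ℝ)) := by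
  rw [tendstoInMeasure_iff_norm]
  intro ε hε
  simp only [sub_zero, Real.norm_eq_abs]
  have hms : ∀ m, MeasurableSet {z | ε ≤ |f m z|} := fun m =>
    measurableSet_le measurable_const (hf m).abs
  have e : ∀ m, μ {ω | ε ≤ |f m (X m ω, Y m ω)|}
      = ∫⁻ ω, κ m (X m ω) {y | ε ≤ |f m (X m ω, y)|} ∂μ := fun m => by
    have h1 := lintegral_of_hasCondDistrib (h m)
      (f := Set.indicator {z | ε ≤ |f m z|} 1) (measurable_one.indicator (hms m))
    rw [← lintegral_map' (f := Set.indicator {z | ε ≤ |f m z|} 1)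
      (measurable_one.indicator (hms m)).aemeasurable (h m).aemeasurable,
      lintegral_indicator_one (hms m), Measure.map_apply_of_aemeasurable (h m).aemeasurable (hms m)]
      at h1
    refine h1.trans (lintegral_congr fun ω => ?_)
    exact lintegral_indicator_one (measurable_prodMk_left (x := X m ω) (hms m))
  simp_rw [e]
  have hdom := tendsto_lintegral_filter_of_dominated_convergence' (μ := μ) (l := atTop)
    (F := fun m ω => κ m (X m ω) {y | ε ≤ |f m (X m ω, y)|}) (f := fun _ => 0) (fun _ => 1)
    (Eventually.of_forall fun m =>
      (Kernel.measurable_kernel_prodMk_left (hms m)).comp_aemeasurable (h m).aemeasurable_fst)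
    (Eventually.of_forall fun m => ae_of_all _ fun ω => prob_le_one) (by simp)
    (by filter_upwards [hlim] with ω hω using hω ε hε)
  simpa using hdom

/-- Convergence in distribution under almost every conditional law, to one and the same limit,
implies convergence in distribution, by dominated convergence. -/
lemma tendstoInDistribution_of_condDistrib (h : ∀ m, HasCondDistrib (Y m) (X m) (κ m) μ)
    {f : ∀ m, 𝓧 m × 𝓨 → ℝ} (hf : ∀ m, Measurable (f m)) {ν : Measure ℝ} [IsProbabilityMeasure ν]
    (hlim : ∀ᵐ ω ∂μ, TendstoInDistribution (fun m y => f m (X m ω, y)) atTop (id : ℝ → ℝ)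
      (fun m => κ m (X m ω)) ν) :
    TendstoInDistribution (fun m ω => f m (X m ω, Y m ω)) atTop (id : ℝ → ℝ) (fun _ => μ) ν where
  forall_aemeasurable m := (hf m).comp_aemeasurable (h m).aemeasurable
  aemeasurable_limit := aemeasurable_id
  tendsto := by
    refine ProbabilityMeasure.tendsto_iff_forall_lintegral_tendsto.2 fun φ => ?_
    have hφ : Measurable fun y : ℝ => (φ y : ℝ≥0∞) := by fun_prop
    simp only [ProbabilityMeasure.coe_mk, Measure.map_id]
    have e : ∀ m, ∫⁻ y, φ y ∂(μ.map fun ω => f m (X m ω, Y m ω))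
        = ∫⁻ ω, ∫⁻ y, φ (f m (X m ω, y)) ∂κ m (X m ω) ∂μ := fun m => by
      exact (lintegral_map' hφ.aemeasurable ((hf m).comp_aemeasurable (h m).aemeasurable)).trans
        (lintegral_of_hasCondDistrib (h m) (hφ.comp (hf m)))
    simp_rw [e]
    have hconst : ∫⁻ y, φ y ∂ν = ∫⁻ _, ∫⁻ y, φ y ∂ν ∂μ := by simp
    rw [hconst]
    refine tendsto_lintegral_filter_of_dominated_convergence' (fun _ => edist 0 φ)
      (Eventually.of_forall fun m => ?_) (Eventually.of_forall fun m => ae_of_all _ fun ω => ?_)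
      (by simp) ?_
    · exact ((hφ.comp (hf m)).lintegral_kernel_prod_right').comp_aemeasurable (h m).aemeasurable_fst
    · calc ∫⁻ y, φ (f m (X m ω, y)) ∂κ m (X m ω) ≤ ∫⁻ _, edist 0 φ ∂κ m (X m ω) :=
            lintegral_mono fun y => φ.apply_le_edist_zero _
        _ = edist 0 φ := by simp
    · filter_upwards [hlim] with ω hω
      have := ProbabilityMeasure.tendsto_iff_forall_lintegral_tendsto.1 hω.tendsto φ
      simp only [ProbabilityMeasure.coe_mk, Measure.map_id] at this
      refine this.congr fun m => ?_
      exact lintegral_map hφ ((hf m).comp measurable_prodMk_left)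

end ConditionalLimits

end

/-- `F` is the true distribution of the data `X 0, X 1, …`, `α` and `H` are the parameters of the
prior `DP(α H)`, and `P m` is the posterior random measure given the first `m` observations: its
conditional law `κ m` given these observations is `DP((α + m) H_m)`, with `H_m` the posterior base
distribution. The limit law and the asymptotic equivalence (the difference of the two statistics
tends to zero in probability) are stated conditionally on almost every data sequence, and also
unconditionally. -/
theorem theorem1 {S : Type*} [MeasurableSpace S] {Ω : Type*} [MeasurableSpace Ω]
    (μ : Measure Ω) [IsProbabilityMeasure μ]
    (F H : Measure S) [IsProbabilityMeasure F] [IsProbabilityMeasure H]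
    (α : ℝ) (hα : 0 < α)
    (X : ℕ → Ω → S) (hX_law : ∀ n, HasLaw (X n) F μ) (hX_indep : iIndepFun X μ)
    (κ : (m : ℕ) → Kernel (Fin m → S) (ProbabilityMeasure S)) [∀ m, IsMarkovKernel (κ m)]
    (hκ : ∀ m, ∀ᵐ ω ∂μ, IsDirichletProcess (κ m fun i : Fin m => X i ω) (α + m)
      (posteriorBase α H fun i : Fin m => X i ω))
    (P : ℕ → Ω → ProbabilityMeasure S)
    (hP : ∀ m, HasCondDistrib (P m) (fun ω (i : Fin m) => X i ω) (κ m) μ)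
    (k : ℕ) (A : Fin k → Set S) (hA : IsMeasurablePartition A) (hFA : ∀ i, 0 < F (A i)) :
    (∀ᵐ ω ∂μ,
      (∀ ε : ℝ, 0 < ε → Tendsto (fun m : ℕ => κ m (fun i : Fin m => X i ω)
          {Q | ε ≤ |2 * (α + m) * klPartition A Q (posteriorBase α H fun i : Fin m => X i ω)
            - chiSqStat A (α + m) Q (posteriorBase α H fun i : Fin m => X i ω)|})
        atTop (𝓝 0)) ∧
      TendstoInDistribution
        (fun (m : ℕ) (Q : ProbabilityMeasure S) =>
          chiSqStat A (α + m) Q (posteriorBase α H fun i : Fin m => X i ω))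
        atTop (id : ℝ → ℝ) (fun m => κ m fun i : Fin m => X i ω) (chiSquared (k - 1))) ∧
    TendstoInMeasure μ
      (fun (m : ℕ) ω =>
        2 * (α + m) * klPartition A (P m ω) (posteriorBase α H fun i : Fin m => X i ω)
          - chiSqStat A (α + m) (P m ω) (posteriorBase α H fun i : Fin m => X i ω))
      atTop (fun _ => (0 : ℝ)) ∧
    TendstoInDistribution
      (fun (m : ℕ) ω =>
        chiSqStat A (α + m) (P m ω) (posteriorBase α H fun i : Fin m => X i ω))
      atTop (id : ℝ → ℝ) (fun _ => μ) (chiSquared (k - 1)) := by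
  -- `h m x` is the vector of the cell probabilities under the posterior base distribution.
  let h : ∀ m : ℕ, (Fin m → S) → Fin k → ℝ := fun m x i => (posteriorBase α H x).real (A i)
  let T : ProbabilityMeasure S → Fin k → ℝ := fun Q i => (Q : Measure S).real (A i)
  have hT : Measurable T :=
    measurable_pi_lambda _ fun i => measurable_probabilityMeasure_real (hA.measurableSet i)
  have hh : ∀ m, Measurable (h m) := fun m =>
    measurable_pi_lambda _ fun i => measurable_posteriorBase_real hα H (hA.measurableSet i)
  let D : ∀ m : ℕ, (Fin m → S) × ProbabilityMeasure S → ℝ := fun m z =>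
    chiSqVec (α + m) (T z.2) (h m z.1)
  let R : ∀ m : ℕ, (Fin m → S) × ProbabilityMeasure S → ℝ := fun m z =>
    2 * (α + m) * klVec (T z.2) (h m z.1) - chiSqVec (α + m) (T z.2) (h m z.1)
  have hD : ∀ m, Measurable (D m) := fun m => by fun_prop
  have hR : ∀ m, Measurable (R m) := fun m => by fun_prop
  have hc : Tendsto (fun m : ℕ => α + (m : ℝ)) atTop atTop :=
    tendsto_atTop_add_const_left _ α tendsto_natCast_atTop_atTop
  have hc0 : ∀ m : ℕ, 0 < α + (m : ℝ) := fun m => by positivity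
  have hp : ∀ i, 0 < F.real (A i) := fun i =>
    ENNReal.toReal_pos (hFA i).ne' (measure_ne_top _ _)
  have hcond : ∀ᵐ ω ∂μ,
      (∀ ε : ℝ, 0 < ε → Tendsto (fun m : ℕ => κ m (fun i : Fin m => X i ω)
        {Q | ε ≤ |R m (fun i : Fin m => X i ω, Q)|}) atTop (𝓝 0)) ∧
      TendstoInDistribution (fun (m : ℕ) Q => D m (fun i : Fin m => X i ω, Q)) atTop (id : ℝ → ℝ)
        (fun m => κ m fun i : Fin m => X i ω) (chiSquared (k - 1)) := by
    filter_upwards [ae_all_iff.2 hκ, ae_all_iff.2 fun i =>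
      ae_tendsto_posteriorBase_real (H := H) hα hX_law hX_indep (hA.measurableSet i)] with ω hω hlim
    have hsum : ∀ m : ℕ, ∑ i, h m (fun i : Fin m => X i ω) i = 1 := fun m => by
      have := isProbabilityMeasure_posteriorBase hα H fun i : Fin m => X i ω
      exact hA.sum_measureReal _
    have hlaw : ∀ m : ℕ, (κ m fun i : Fin m => X i ω).map T
        = dirichletLaw fun i => (α + m) * h m (fun i : Fin m => X i ω) i := fun m => by
      have := isProbabilityMeasure_posteriorBase hα H fun i : Fin m => X i ω
      exact (hω m).map_eq (hc0 m) hA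
    refine ⟨fun ε hε => ?_, tendstoInDistribution_id_of_map_eq
      (fun m => (hD m).comp measurable_prodMk_left) (fun m => ?_)
      (tendsto_dirichletLaw_chiSqVec hc hp hlim hc0 hsum)⟩
    · refine (tendsto_dirichletLaw_klVec_sub_chiSqVec hc hp hlim hc0 hsum hε).congr fun m => ?_
      rw [← hlaw, Measure.map_apply hT]
      · rfl
      · exact measurableSet_le measurable_const (by fun_prop)
    · change _ = Measure.map _ (dirichletLaw fun i => (α + m) * h m (fun i : Fin m => X i ω) i)
      rw [← hlaw, Measure.map_map (by fun_prop) hT]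
      rfl
  have hRP := tendstoInMeasure_zero_of_condDistrib (𝓧 := fun m => Fin m → S)
    (X := fun m ω (i : Fin m) => X i ω) hP hR (hcond.mono fun ω hω => hω.1)
  have hDP := tendstoInDistribution_of_condDistrib (𝓧 := fun m => Fin m → S)
    (X := fun m ω (i : Fin m) => X i ω) hP hD (hcond.mono fun ω hω => hω.2)
  exact ⟨hcond, hRP, hDP⟩
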